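/- For $f\in L^2(\mathbb{R})$ (complex-valued, $f\neq 0$) let $\mu(f)=\frac{1}{\|f\|_2^2}\int_{\mathbb{R}} t|f(t)|^2\,dt$ be its mean, and $\Delta(f)=\left(\int_{\mathbb{R}}|t-\mu(f)|^2|f(t)|^2\,dt\right)^{1/2}\in[0,\infty]$ its dispersion, where $\Delta(f)=\infty$ if $t f(t)\notin L^2(\mathbb{R})$. Let $\widehat f$ denote the Fourier transform on $L^2(\mathbb{R})$, i.e. the extension by continuity of $\widehat f(\xi)=\int_{\mathbb{R}} f(x)e^{-2i\pi x\xi}\,dx$ from $L^1(\mathbb{R})\cap L^2(\mathbb{R})$. Corollary (Jaming--Powell). Let $C\in\mathbb{R}$ and let $\{e_k\}$ be an orthonormal (finite or infinite) sequence, or more generally an orthonormal family, in $L^2(\mathbb{R})$ such that $\Delta(e_k)$, $\Delta(\widehat{e_k})$, $|\mu(e_k)|$, $|\mu(\widehat{e_k})|$ are all at most $C$ for every $k$. Then the family is finite and has at most $8\pi C^2$ elements. -/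

import Mathlib

open MeasureTheory
open scoped ENNReal FourierTransform

/-- The complex Hilbert space `L²(ℝ)` for Lebesgue measure. -/
abbrev L2R : Type := Lp ℂ 2 (volume : Measure ℝ)

/-- The mean `μ(f) = ‖f‖₂⁻² ∫ t |f(t)|² dt` of `f ∈ L²(ℝ)`. -/
noncomputable def l2Mean (f : L2R) : ℝ :=
  1 / ‖f‖ ^ 2 * ∫ t : ℝ, t * ‖f t‖ ^ 2

/-- The variance `Δ²(f) = ∫ |t - μ(f)|² |f(t)|² dt` of `f ∈ L²(ℝ)`, with values in `[0, ∞]`.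
It is finite exactly when `t f(t)` is square integrable, since `∫ |t - a|² |f(t)|² dt` is infinite
for every real `a` otherwise. In that case `t |f(t)|²` is integrable, so the integral that
defines the mean converges. -/
noncomputable def l2Variance (f : L2R) : ℝ≥0∞ :=
  ∫⁻ t : ℝ, ENNReal.ofReal (|t - l2Mean f| ^ 2 * ‖f t‖ ^ 2)

/-- The dispersion `Δ(f) = √(Δ²(f))` of `f ∈ L²(ℝ)`, with values in `[0, ∞]`. -/
noncomputable def l2Dispersion (f : L2R) : ℝ≥0∞ :=
  l2Variance f ^ (1 / 2 : ℝ)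

/-! The form `2π(‖t f‖² + ‖t 𝓕f‖²)` is that of the harmonic oscillator, which the Hermite functions
`h_k` diagonalize with eigenvalues `2k + 1`. For each `e_i` the hypotheses bound both second moments
by `2C²`, so its energy is at most `8πC²` (`exists_coe_eq_mul_and_norm_sq_le`,
`sum_hermite_energy_le`). For `N` members of the family put `w_k = ∑ᵢ |⟨h_k, e_i⟩|²`. Bessel gives
`w_k ≤ 1`; Parseval, i.e. completeness of the `h_k`, gives `∑ w_k = N`. Such weights have least
energy when they fill the first `N` levels, so `N² = 1 + 3 + ⋯ + (2N - 1) ≤ N · 8πC²`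
(`sq_le_of_hasSum`). -/

open scoped SchwartzMap Polynomial

/-! ### The Gaussian as a Schwartz function -/

/-- `|x|^k e^{-πx²}` is bounded. -/
theorem exists_abs_pow_mul_gaussian_le (k : ℕ) :
    ∃ C : ℝ, ∀ x : ℝ, |x| ^ k * Real.exp (-Real.pi * x ^ 2) ≤ C := by
  refine ⟨k.factorial * Real.exp 1, fun x => ?_⟩
  have h1 : |x| ^ k ≤ k.factorial * Real.exp |x| := by
    have := Real.pow_div_factorial_le_exp |x| (abs_nonneg x) k
    rwa [div_le_iff₀' (by positivity)] at this
  calc |x| ^ k * Real.exp (-Real.pi * x ^ 2)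
      ≤ k.factorial * Real.exp |x| * Real.exp (-Real.pi * x ^ 2) := by gcongr
    _ = k.factorial * Real.exp (|x| + -Real.pi * x ^ 2) := by rw [mul_assoc, Real.exp_add]
    _ ≤ _ := by
      gcongr
      have := Real.pi_gt_three
      nlinarith [sq_abs x, sq_nonneg (|x| - 1), sq_nonneg x]

theorem exists_abs_pow_mul_polynomial_gaussian_le (P : ℝ[X]) (k : ℕ) :
    ∃ C : ℝ, ∀ x : ℝ, |x| ^ k * |P.eval x * Real.exp (-Real.pi * x ^ 2)| ≤ C := by
  induction P using Polynomial.induction_on' with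
  | add p q hp hq =>
    obtain ⟨C, hC⟩ := hp
    obtain ⟨D, hD⟩ := hq
    refine ⟨C + D, fun x => ?_⟩
    calc _ ≤ |x| ^ k * (|p.eval x * Real.exp (-Real.pi * x ^ 2)| +
          |q.eval x * Real.exp (-Real.pi * x ^ 2)|) := by
          rw [Polynomial.eval_add, add_mul]
          gcongr
          exact abs_add_le _ _
      _ ≤ _ := by rw [mul_add]; exact add_le_add (hC x) (hD x)
  | monomial n a =>
    obtain ⟨C, hC⟩ := exists_abs_pow_mul_gaussian_le (k + n)
    refine ⟨|a| * C, fun x => ?_⟩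
    rw [Polynomial.eval_monomial, abs_mul, abs_mul, abs_pow, Real.abs_exp]
    calc _ = |a| * (|x| ^ (k + n) * Real.exp (-Real.pi * x ^ 2)) := by ring
      _ ≤ _ := by gcongr; exact hC x

theorem hasDerivAt_gaussian (x : ℝ) : HasDerivAt (fun x : ℝ => Real.exp (-Real.pi * x ^ 2))
    (-(2 * Real.pi * x) * Real.exp (-Real.pi * x ^ 2)) x := by
  have h : HasDerivAt (fun x : ℝ => -Real.pi * x ^ 2) (-Real.pi * (2 * x)) x := by
    simpa using (hasDerivAt_pow 2 x).const_mul (-Real.pi)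
  convert h.exp using 1
  ring

/-- Differentiation acts on the polynomial factor by `P ↦ P' - 2πXP`; this reduces Schwartz decay to
polynomial times Gaussian. -/
theorem exists_iteratedDeriv_gaussian_eq (n : ℕ) : ∃ P : ℝ[X],
    iteratedDeriv n (fun x : ℝ => ((Real.exp (-Real.pi * x ^ 2) : ℝ) : ℂ)) =
      fun x => ((P.eval x * Real.exp (-Real.pi * x ^ 2) : ℝ) : ℂ) := by
  induction n with
  | zero => exact ⟨1, by simp⟩
  | succ n ih =>
    obtain ⟨P, hP⟩ := ih
    refine ⟨P.derivative - Polynomial.C (2 * Real.pi) * Polynomial.X * P, ?_⟩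
    rw [iteratedDeriv_succ, hP]
    funext x
    have := ((P.hasDerivAt x).mul (hasDerivAt_gaussian x)).ofReal_comp.deriv
    refine this.trans ?_
    congr 1
    simp
    ring

/-- The Gaussian `e^{-πx²}` as a Schwartz function. -/
noncomputable def gaussianSchwartz : 𝓢(ℝ, ℂ) where
  toFun x := ((Real.exp (-Real.pi * x ^ 2) : ℝ) : ℂ)
  smooth' := by
    have : ContDiff ℝ (⊤ : ℕ∞) (fun x : ℝ => Real.exp (-Real.pi * x ^ 2)) := by fun_prop
    exact Complex.ofRealCLM.contDiff.comp this
  decay' k n := by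
    obtain ⟨P, hP⟩ := exists_iteratedDeriv_gaussian_eq n
    obtain ⟨C, hC⟩ := exists_abs_pow_mul_polynomial_gaussian_le P k
    refine ⟨C, fun x => ?_⟩
    rw [norm_iteratedFDeriv_eq_norm_iteratedDeriv, hP, Complex.norm_real]
    exact hC x

theorem gaussianSchwartz_apply (x : ℝ) :
    gaussianSchwartz x = ((Real.exp (-Real.pi * x ^ 2) : ℝ) : ℂ) := rfl

theorem fourier_gaussianSchwartz : 𝓕 gaussianSchwartz = gaussianSchwartz := by
  ext x
  have h := fourier_gaussian_pi (b := 1) (by simp)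
  have hg : (gaussianSchwartz : ℝ → ℂ) = fun x : ℝ => Complex.exp (-Real.pi * 1 * x ^ 2) := by
    funext x
    rw [gaussianSchwartz_apply]
    push_cast
    simp
  rw [SchwartzMap.fourier_coe, hg, h]
  simp

/-! ### Ladder operators and Hermite functions -/

/-- Multiplication by the variable on Schwartz functions. -/
noncomputable def mulX : 𝓢(ℝ, ℂ) →L[ℂ] 𝓢(ℝ, ℂ) :=
  SchwartzMap.smulLeftCLM ℂ (fun x : ℝ => x)

theorem mulX_apply (φ : 𝓢(ℝ, ℂ)) (x : ℝ) : mulX φ x = x * φ x := by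
  rw [mulX, SchwartzMap.smulLeftCLM_apply_apply (by fun_prop)]
  simp

/-- Differentiation on Schwartz functions. -/
noncomputable abbrev derivS : 𝓢(ℝ, ℂ) →L[ℂ] 𝓢(ℝ, ℂ) := SchwartzMap.derivCLM ℂ ℂ

theorem derivS_mulX (φ : 𝓢(ℝ, ℂ)) : derivS (mulX φ) = mulX (derivS φ) + φ := by
  ext x
  have h : HasDerivAt (mulX φ : ℝ → ℂ) (1 * φ x + x * deriv φ x) x := by
    have := (Complex.ofRealCLM.hasDerivAt (x := x)).mul (φ.hasDerivAt x)
    refine (this.congr_of_eventuallyEq (Filter.Eventually.of_forall fun y => ?_)).congr_deriv ?_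
    · simp [mulX_apply]
    · simp
  simp only [SchwartzMap.derivCLM_apply, add_apply, mulX_apply, h.deriv]
  ring

/-- The operator `2πX - d/dx`. -/
noncomputable def creation (φ : 𝓢(ℝ, ℂ)) : 𝓢(ℝ, ℂ) := (2 * Real.pi : ℂ) • mulX φ - derivS φ

/-- The operator `2πX + d/dx`. -/
noncomputable def annihilation (φ : 𝓢(ℝ, ℂ)) : 𝓢(ℝ, ℂ) := (2 * Real.pi : ℂ) • mulX φ + derivS φ

/-- The canonical commutation relation `[d/dx, X] = 1`, scaled. -/
theorem annihilation_creation (φ : 𝓢(ℝ, ℂ)) :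
    annihilation (creation φ) = creation (annihilation φ) + (4 * Real.pi : ℂ) • φ := by
  simp only [annihilation, creation, map_sub, map_add, map_smul, derivS_mulX]
  module

theorem annihilation_gaussian : annihilation gaussianSchwartz = 0 := by
  ext x
  have h := (hasDerivAt_gaussian x).ofReal_comp.deriv
  have h' : deriv (gaussianSchwartz : ℝ → ℂ) x =
    ((-(2 * Real.pi * x) * Real.exp (-Real.pi * x ^ 2) : ℝ) : ℂ) := h
  simp only [annihilation, add_apply, smul_apply, mulX_apply,
    SchwartzMap.derivCLM_apply, h', gaussianSchwartz_apply]
  push_cast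
  simp
  ring

theorem creation_smul (c : ℂ) (φ : 𝓢(ℝ, ℂ)) : creation (c • φ) = c • creation φ := by
  simp only [creation, map_smul]
  module

/-- The (unnormalized) Hermite functions. -/
noncomputable def hermiteFun : ℕ → 𝓢(ℝ, ℂ)
  | 0 => gaussianSchwartz
  | k + 1 => creation (hermiteFun k)

theorem hermiteFun_succ (k : ℕ) : hermiteFun (k + 1) = creation (hermiteFun k) := rfl

theorem annihilation_hermiteFun_succ (k : ℕ) :
    annihilation (hermiteFun (k + 1)) = (4 * Real.pi * (k + 1) : ℂ) • hermiteFun k := by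
  induction k with
  | zero =>
    rw [zero_add, hermiteFun_succ 0, annihilation_creation, hermiteFun, annihilation_gaussian]
    simp [creation]
  | succ k ih =>
    rw [hermiteFun, annihilation_creation, ih, creation_smul, ← hermiteFun, ← add_smul]
    push_cast
    congr 1
    ring

theorem annihilation_hermiteFun (k : ℕ) :
    annihilation (hermiteFun k) = (4 * Real.pi * k : ℂ) • hermiteFun (k - 1) := by
  cases k with
  | zero => simp [hermiteFun, annihilation_gaussian]
  | succ k => simp [annihilation_hermiteFun_succ]

/-- Creation plus annihilation is `4πX`. At `k = 0` the truncated index `k - 1` is harmless, its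
coefficient being zero. -/
theorem mulX_hermiteFun (k : ℕ) : (4 * Real.pi : ℂ) • mulX (hermiteFun k) =
    hermiteFun (k + 1) + (4 * Real.pi * k : ℂ) • hermiteFun (k - 1) := by
  rw [← annihilation_hermiteFun, hermiteFun, creation, annihilation]
  module

/-! ### Hermite functions as Fourier eigenfunctions -/

theorem smulLeftCLM_inner_one (φ : 𝓢(ℝ, ℂ)) :
    SchwartzMap.smulLeftCLM ℂ (fun x : ℝ => inner ℝ x (1 : ℝ)) φ = mulX φ := by
  ext x
  rw [SchwartzMap.smulLeftCLM_apply_apply (by fun_prop), mulX_apply]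
  simp

open LineDeriv in
theorem lineDerivOp_one (φ : 𝓢(ℝ, ℂ)) : ∂_{(1 : ℝ)} φ = derivS φ := by
  ext x
  rw [SchwartzMap.lineDerivOp_apply_eq_fderiv, SchwartzMap.derivCLM_apply, fderiv_apply_one_eq_deriv]

theorem fourier_derivS (φ : 𝓢(ℝ, ℂ)) :
    𝓕 (derivS φ) = (2 * Real.pi * Complex.I : ℂ) • mulX (𝓕 φ) := by
  rw [← lineDerivOp_one, SchwartzMap.fourier_lineDerivOp_eq, smulLeftCLM_inner_one]

theorem derivS_fourier (φ : 𝓢(ℝ, ℂ)) :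
    derivS (𝓕 φ) = -(2 * Real.pi * Complex.I : ℂ) • 𝓕 (mulX φ) := by
  rw [← lineDerivOp_one, SchwartzMap.lineDerivOp_fourier_eq, smulLeftCLM_inner_one,
    FourierTransform.fourier_smul]

theorem fourier_creation (φ : 𝓢(ℝ, ℂ)) : 𝓕 (creation φ) = (-Complex.I) • creation (𝓕 φ) := by
  have hsub : 𝓕 ((2 * Real.pi : ℂ) • mulX φ - derivS φ) =
      𝓕 ((2 * Real.pi : ℂ) • mulX φ) - 𝓕 (derivS φ) :=
    map_sub (SchwartzMap.fourierTransformCLM ℂ) _ _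
  rw [creation, creation, hsub, FourierTransform.fourier_smul,
    fourier_derivS, derivS_fourier, smul_sub, smul_smul, smul_smul]
  have : -Complex.I * -(2 * Real.pi * Complex.I) = -(2 * Real.pi : ℂ) := by
    linear_combination (2 * Real.pi : ℂ) * Complex.I_mul_I
  rw [this]
  module

theorem fourier_hermiteFun (k : ℕ) : 𝓕 (hermiteFun k) = (-Complex.I) ^ k • hermiteFun k := by
  induction k with
  | zero => simp [hermiteFun, fourier_gaussianSchwartz]
  | succ k ih => rw [hermiteFun, fourier_creation, ih, creation_smul, smul_smul, pow_succ']

/-! ### Orthogonality in `L²` -/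

/-- The Hermite functions as elements of `L²(ℝ)`. -/
noncomputable def hermiteLp (k : ℕ) : L2R := (hermiteFun k).toLp 2

theorem inner_toLp_eq_integral (φ : 𝓢(ℝ, ℂ)) (f : L2R) :
    inner ℂ (φ.toLp 2 volume) f = ∫ x, inner ℂ (φ x) (f x) := by
  rw [L2.inner_def]
  refine integral_congr_ae ?_
  filter_upwards [φ.coeFn_toLp 2 volume] with x hx
  rw [hx]

theorem inner_toLp_toLp_eq_integral (φ ψ : 𝓢(ℝ, ℂ)) :
    inner ℂ (φ.toLp 2 volume) (ψ.toLp 2 volume) = ∫ x, inner ℂ (φ x) (ψ x) := by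
  rw [inner_toLp_eq_integral]
  refine integral_congr_ae ?_
  filter_upwards [ψ.coeFn_toLp 2 volume] with x hx
  rw [hx]

theorem inner_toLp_mulX (φ ψ : 𝓢(ℝ, ℂ)) :
    inner ℂ ((mulX φ).toLp 2 volume) (ψ.toLp 2 volume) =
      inner ℂ (φ.toLp 2 volume) ((mulX ψ).toLp 2 volume) := by
  rw [inner_toLp_toLp_eq_integral, inner_toLp_toLp_eq_integral]
  congr 1
  funext x
  simp [mulX_apply]
  ring

theorem inner_toLp_derivS (φ ψ : 𝓢(ℝ, ℂ)) :
    inner ℂ ((derivS φ).toLp 2 volume) (ψ.toLp 2 volume) =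
      -inner ℂ (φ.toLp 2 volume) ((derivS ψ).toLp 2 volume) := by
  rw [inner_toLp_toLp_eq_integral, inner_toLp_toLp_eq_integral, eq_neg_iff_add_eq_zero,
    add_comm, ← eq_neg_iff_add_eq_zero]
  have := SchwartzMap.integral_bilinear_deriv_right_eq_neg_left φ ψ
    ((ContinuousLinearMap.mul ℝ ℂ).comp Complex.conjCLE.toContinuousLinearMap)
  simpa [mul_comm] using this

theorem toLp_creation (φ : 𝓢(ℝ, ℂ)) : (creation φ).toLp 2 (volume : Measure ℝ) =
    (2 * Real.pi : ℂ) • (mulX φ).toLp 2 volume - (derivS φ).toLp 2 volume := by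
  simp only [creation, ← SchwartzMap.toLpCLM_apply (𝕜 := ℂ), map_sub, map_smul]

theorem toLp_annihilation (φ : 𝓢(ℝ, ℂ)) : (annihilation φ).toLp 2 (volume : Measure ℝ) =
    (2 * Real.pi : ℂ) • (mulX φ).toLp 2 volume + (derivS φ).toLp 2 volume := by
  simp only [annihilation, ← SchwartzMap.toLpCLM_apply (𝕜 := ℂ), map_add, map_smul]

/-- `X` is symmetric and `d/dx` is skew, by integration by parts. Orthogonality and the norms of the
Hermite functions follow from this adjointness. -/
theorem inner_creation (φ ψ : 𝓢(ℝ, ℂ)) :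
    inner ℂ ((creation φ).toLp 2 volume) (ψ.toLp 2 volume) =
      inner ℂ (φ.toLp 2 volume) ((annihilation ψ).toLp 2 volume) := by
  rw [toLp_creation, toLp_annihilation, inner_sub_left, inner_add_right, inner_smul_left,
    inner_smul_right, inner_toLp_mulX, inner_toLp_derivS]
  have : (starRingEnd ℂ) 2 = 2 := map_ofNat _ 2
  simp [this]

theorem toLp_smul_schwartz (c : ℂ) (φ : 𝓢(ℝ, ℂ)) :
    (c • φ).toLp 2 (volume : Measure ℝ) = c • φ.toLp 2 volume := rfl

theorem inner_hermiteLp_succ_succ (j k : ℕ) :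
    inner ℂ (hermiteLp (j + 1)) (hermiteLp (k + 1)) =
      (4 * Real.pi * (k + 1) : ℂ) * inner ℂ (hermiteLp j) (hermiteLp k) := by
  rw [hermiteLp, hermiteLp, hermiteFun, inner_creation, annihilation_hermiteFun_succ,
    toLp_smul_schwartz, inner_smul_right, hermiteLp, hermiteLp]

theorem inner_hermiteLp_succ_zero (j : ℕ) :
    inner ℂ (hermiteLp (j + 1)) (hermiteLp 0) = 0 := by
  rw [hermiteLp, hermiteLp, hermiteFun_succ, inner_creation, annihilation_hermiteFun]
  simp

theorem inner_hermiteLp_of_ne {j k : ℕ} (h : j ≠ k) :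
    inner ℂ (hermiteLp j) (hermiteLp k) = 0 := by
  induction j generalizing k with
  | zero =>
    obtain ⟨k, rfl⟩ := Nat.exists_eq_succ_of_ne_zero h.symm
    rw [← inner_conj_symm, inner_hermiteLp_succ_zero, map_zero]
  | succ j ih =>
    cases k with
    | zero => exact inner_hermiteLp_succ_zero j
    | succ k => rw [inner_hermiteLp_succ_succ, ih (by omega), mul_zero]

theorem norm_hermiteLp_succ_sq (k : ℕ) :
    ‖hermiteLp (k + 1)‖ ^ 2 = 4 * Real.pi * (k + 1) * ‖hermiteLp k‖ ^ 2 := by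
  have h := inner_hermiteLp_succ_succ k k
  rw [inner_self_eq_norm_sq_to_K, inner_self_eq_norm_sq_to_K] at h
  have h' : ((‖hermiteLp (k + 1)‖ ^ 2 : ℝ) : ℂ) =
      ((4 * Real.pi * (k + 1) * ‖hermiteLp k‖ ^ 2 : ℝ) : ℂ) := by
    push_cast
    exact h
  exact Complex.ofReal_injective h'

theorem hermiteLp_zero_ne_zero : hermiteLp 0 ≠ 0 := by
  intro h
  have h' : gaussianSchwartz = 0 :=
    SchwartzMap.injective_toLp 2 volume (h.trans (map_zero (SchwartzMap.toLpCLM ℂ ℂ 2 volume)).symm)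
  have := congrArg (fun φ : 𝓢(ℝ, ℂ) => φ 0) h'
  simp [gaussianSchwartz_apply] at this

theorem norm_hermiteLp_pos (k : ℕ) : 0 < ‖hermiteLp k‖ := by
  induction k with
  | zero => exact norm_pos_iff.2 hermiteLp_zero_ne_zero
  | succ k ih =>
    have h := norm_hermiteLp_succ_sq k
    have : 0 < ‖hermiteLp (k + 1)‖ ^ 2 := by rw [h]; positivity
    exact (norm_nonneg _).lt_of_ne fun h0 => by simp [← h0] at this

/-- The normalized Hermite functions in `L²(ℝ)`. -/
noncomputable def hermiteONB (k : ℕ) : L2R := ((‖hermiteLp k‖⁻¹ : ℝ) : ℂ) • hermiteLp k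

theorem orthonormal_hermiteONB : Orthonormal ℂ hermiteONB := by
  refine ⟨fun k => ?_, fun j k h => ?_⟩
  · rw [hermiteONB, norm_smul, Complex.norm_real, norm_inv, norm_norm,
      inv_mul_cancel₀ (norm_hermiteLp_pos k).ne']
  · simp only [hermiteONB]
    rw [inner_smul_left, inner_smul_right, inner_hermiteLp_of_ne h]
    simp

theorem norm_inner_hermiteONB_sq (k : ℕ) (f : L2R) :
    ‖inner ℂ (hermiteONB k) f‖ ^ 2 = ‖inner ℂ (hermiteLp k) f‖ ^ 2 / ‖hermiteLp k‖ ^ 2 := by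
  rw [hermiteONB, inner_smul_left, norm_mul, RCLike.norm_conj, Complex.norm_real, norm_inv,
    norm_norm]
  field_simp

theorem fourier_hermiteLp (k : ℕ) : 𝓕 (hermiteLp k) = (-Complex.I) ^ k • hermiteLp k := by
  rw [hermiteLp, SchwartzMap.toLp_fourier_eq, fourier_hermiteFun, toLp_smul_schwartz]

theorem inner_hermiteLp_fourier (k : ℕ) (f : L2R) :
    inner ℂ (hermiteLp k) (𝓕 f) = (-Complex.I) ^ k * inner ℂ (hermiteLp k) f := by
  have h := Lp.inner_fourier_eq (hermiteLp k) f
  rw [fourier_hermiteLp, inner_smul_left] at h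
  rw [← h, ← mul_assoc, map_pow, ← mul_pow]
  simp

/-! ### Completeness -/

theorem mulX_iterate_apply (φ : 𝓢(ℝ, ℂ)) (n : ℕ) (x : ℝ) : (mulX^[n] φ) x = x ^ n * φ x := by
  induction n with
  | zero => simp
  | succ n ih => rw [Function.iterate_succ_apply', mulX_apply, ih]; ring

/-- By the recurrence, `x · h_k` is a combination of neighbouring Hermite functions, so
orthogonality survives each factor `x`. The case `k = 0` kills all moments of `f` against the
Gaussian. -/
theorem inner_mulX_iterate_eq_zero {f : L2R} (hf : ∀ k, inner ℂ (hermiteLp k) f = 0) (n : ℕ) :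
    ∀ k, inner ℂ ((mulX^[n] (hermiteFun k)).toLp 2 volume) f = 0 := by
  induction n with
  | zero => exact hf
  | succ n ih =>
    intro k
    have h4 : (4 * Real.pi : ℂ) ≠ 0 := by simp [Real.pi_ne_zero]
    have hit : (4 * Real.pi : ℂ) • mulX^[n + 1] (hermiteFun k) = mulX^[n] (hermiteFun (k + 1)) +
        (4 * Real.pi * k : ℂ) • mulX^[n] (hermiteFun (k - 1)) := by
      ext x
      have h := congrArg (fun φ : 𝓢(ℝ, ℂ) => φ x) (mulX_hermiteFun k)
      simp only [smul_apply, add_apply, smul_eq_mul, mulX_apply] at h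
      simp only [smul_apply, add_apply, smul_eq_mul, mulX_iterate_apply]
      linear_combination (x : ℂ) ^ n * h
    have hlp : (4 * Real.pi : ℂ) • (mulX^[n + 1] (hermiteFun k)).toLp 2 (volume : Measure ℝ) =
        (mulX^[n] (hermiteFun (k + 1))).toLp 2 volume +
        (4 * Real.pi * k : ℂ) • (mulX^[n] (hermiteFun (k - 1))).toLp 2 volume := by
      rw [← toLp_smul_schwartz, hit]
      rfl
    have := congrArg (fun g => inner ℂ g f) hlp
    simp only [inner_add_left, inner_smul_left, ih, mul_zero, add_zero] at this
    exact (mul_eq_zero.1 this).resolve_left ((map_ne_zero _).2 h4)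

theorem integral_pow_mul_gaussian_mul_eq_zero {f : L2R}
    (hf : ∀ k, inner ℂ (hermiteLp k) f = 0) (n : ℕ) :
    ∫ x : ℝ, (x : ℂ) ^ n * (gaussianSchwartz x * f x) = 0 := by
  have h := inner_mulX_iterate_eq_zero hf n 0
  rw [inner_toLp_eq_integral] at h
  rw [← h]
  congr 1
  funext x
  simp only [mulX_iterate_apply, hermiteFun, gaussianSchwartz_apply, RCLike.inner_apply, map_mul,
    map_pow, Complex.conj_ofReal]
  ring

theorem integrable_exp_mul_gaussian_mul (f : L2R) (a : ℝ) :
    Integrable fun x : ℝ => Real.exp (a * |x|) * ‖gaussianSchwartz x * f x‖ := by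
  have h1 : MemLp (fun x : ℝ => Real.exp (a * |x|) * Real.exp (-Real.pi * x ^ 2)) 2 volume := by
    have hc : AEStronglyMeasurable
        (fun x : ℝ => Real.exp (a * |x|) * Real.exp (-Real.pi * x ^ 2)) volume := by
      have : Continuous (fun x : ℝ => Real.exp (a * |x|) * Real.exp (-Real.pi * x ^ 2)) := by
        fun_prop
      exact this.aestronglyMeasurable
    rw [memLp_two_iff_integrable_sq hc]
    refine ((integrable_exp_neg_mul_sq (b := Real.pi) Real.pi_pos).const_mul
      (Real.exp (a ^ 2))).mono' (hc.pow 2) (Filter.Eventually.of_forall fun x => ?_)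
    rw [Real.norm_of_nonneg (by positivity), ← Real.exp_add, ← Real.exp_add, ← Real.exp_nat_mul]
    apply Real.exp_le_exp.2
    have := Real.pi_gt_three
    push_cast
    -- `2a|x| ≤ a² + x² ≤ a² + πx²`.
    nlinarith [sq_nonneg (a - |x|), sq_abs x, sq_nonneg x]
  refine (h1.integrable_mul (Lp.memLp f).norm).congr (Filter.Eventually.of_forall fun x => ?_)
  beta_reduce
  rw [norm_mul, gaussianSchwartz_apply, Complex.norm_real, Real.norm_of_nonneg (Real.exp_nonneg _),
    ← mul_assoc]
  rfl

theorem integrable_gaussian_mul (f : L2R) : Integrable fun x : ℝ => gaussianSchwartz x * f x := by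
  have h := integrable_exp_mul_gaussian_mul f 0
  simp only [zero_mul, Real.exp_zero, one_mul] at h
  exact (integrable_norm_iff
    (gaussianSchwartz.continuous.aestronglyMeasurable.mul (Lp.aestronglyMeasurable f))).1 h

/-- A function whose moments against the Gaussian vanish has `f e^{-πx²}` with zero Fourier
transform. -/
theorem fourier_gaussian_mul_eq_zero {f : L2R}
    (hf : ∀ n : ℕ, ∫ x : ℝ, (x : ℂ) ^ n * (gaussianSchwartz x * f x) = 0) (ξ : ℝ) :
    𝓕 (fun x : ℝ => gaussianSchwartz x * f x) ξ = 0 := by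
  set c : ℂ := -(2 * Real.pi * ξ * Complex.I) with hc
  have hm : AEStronglyMeasurable (fun x : ℝ => gaussianSchwartz x * f x) volume :=
    (integrable_gaussian_mul f).1
  have hexp (z : ℂ) : HasSum (fun n : ℕ => z ^ n / n.factorial) (Complex.exp z) := by
    rw [Complex.exp_eq_exp_ℂ]
    exact NormedSpace.expSeries_div_hasSum_exp z
  have hexpr (z : ℝ) : HasSum (fun n : ℕ => z ^ n / n.factorial) (Real.exp z) := by
    rw [Real.exp_eq_exp_ℝ]
    exact NormedSpace.expSeries_div_hasSum_exp z
  -- Expand the Fourier character in its power series and integrate termwise; each term is a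
  -- vanishing moment, and `e^{‖c‖|x|}` times the Gaussian dominates.
  have key := hasSum_integral_of_dominated_convergence (μ := (volume : Measure ℝ))
    (F := fun (n : ℕ) (x : ℝ) => (c * x) ^ n / n.factorial * (gaussianSchwartz x * f x))
    (f := fun x : ℝ => Complex.exp (c * x) * (gaussianSchwartz x * f x))
    (fun n x => (‖c‖ * |x|) ^ n / n.factorial * ‖gaussianSchwartz x * f x‖)
    (fun n => by
      have : Continuous (fun x : ℝ => (c * x) ^ n / n.factorial) := by fun_prop
      exact this.aestronglyMeasurable.mul hm)
    (fun n => Filter.Eventually.of_forall fun x => by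
      simp [mul_pow])
    (Filter.Eventually.of_forall fun x => (hexpr _).summable.mul_right _)
    (by
      refine (integrable_exp_mul_gaussian_mul f ‖c‖).congr (Filter.Eventually.of_forall fun x => ?_)
      beta_reduce
      rw [tsum_mul_right, (hexpr _).tsum_eq])
    (Filter.Eventually.of_forall fun x => (hexp _).mul_right _)
  have hz : ∀ n : ℕ, ∫ x : ℝ, (c * x) ^ n / n.factorial * (gaussianSchwartz x * f x) = 0 := by
    intro n
    have : ∀ x : ℝ, (c * x) ^ n / n.factorial * (gaussianSchwartz x * f x) =
        (c ^ n / n.factorial) * ((x : ℂ) ^ n * (gaussianSchwartz x * f x)) := fun x => by ring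
    simp_rw [this]
    rw [integral_const_mul, hf, mul_zero]
  simp only [hz] at key
  rw [Real.fourier_eq']
  rw [← key.unique hasSum_zero]
  congr 1
  funext x
  rw [smul_eq_mul, hc]
  congr 2
  simp
  ring

/-- An integrable function with zero Fourier transform vanishes almost everywhere. -/
theorem ae_eq_zero_of_fourier_eq_zero {w : ℝ → ℂ} (hw : Integrable w) (h : ∀ ξ, 𝓕 w ξ = 0) :
    ∀ᵐ x, w x = 0 := by
  refine ae_eq_zero_of_integral_contDiff_smul_eq_zero hw.locallyIntegrable fun g hg hgs => ?_
  have hg' : ContDiff ℝ (⊤ : ℕ∞) (fun x => (g x : ℂ)) := Complex.ofRealCLM.contDiff.comp hg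
  have hgs' : HasCompactSupport (fun x => (g x : ℂ)) := hgs.comp_left (g := Complex.ofReal) rfl
  set ψ : 𝓢(ℝ, ℂ) := hgs'.toSchwartzMap hg' with hψ
  -- Duality `∫ 𝓕w · φ = ∫ w · 𝓕φ` with `φ = 𝓕⁻ψ`, so that `w` is tested against `ψ` itself.
  have hflip := VectorFourier.integral_fourierIntegral_smul_eq_flip (μ := volume) (ν := volume)
    (L := innerₗ ℝ) Real.continuous_fourierChar continuous_inner hw (𝓕⁻ ψ).integrable
  have h1 : ∫ x, w x • 𝓕 (𝓕⁻ ψ) x = 0 := by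
    rw [SchwartzMap.fourier_coe]
    refine Eq.trans ?_ (hflip.symm.trans ?_)
    · rw [flip_innerₗ]; rfl
    · have : ∀ ξ, VectorFourier.fourierIntegral Real.fourierChar volume (innerₗ ℝ) w ξ = 0 := h
      simp [this]
  rw [FourierTransform.fourier_fourierInv_eq] at h1
  rw [← h1]
  congr 1
  funext x
  have : ψ x = (g x : ℂ) := rfl
  rw [this]
  simp [mul_comm]

theorem eq_zero_of_inner_hermiteLp_eq_zero {f : L2R} (hf : ∀ k, inner ℂ (hermiteLp k) f = 0) :
    f = 0 := by
  have h := ae_eq_zero_of_fourier_eq_zero (integrable_gaussian_mul f)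
    (fourier_gaussian_mul_eq_zero (integral_pow_mul_gaussian_mul_eq_zero hf))
  rw [Lp.eq_zero_iff_ae_eq_zero]
  filter_upwards [h] with x hx
  refine (mul_eq_zero.1 hx).resolve_left ?_
  rw [gaussianSchwartz_apply]
  exact_mod_cast (Real.exp_pos _).ne'

theorem hermiteONB_orthogonal_eq_bot : (Submodule.span ℂ (Set.range hermiteONB))ᗮ = ⊥ := by
  rw [eq_bot_iff]
  intro f hf
  refine eq_zero_of_inner_hermiteLp_eq_zero fun k => ?_
  have h : inner ℂ (hermiteONB k) f = 0 :=
    Submodule.inner_right_of_mem_orthogonal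
      (Submodule.subset_span (Set.mem_range_self k)) hf
  have h2 := norm_inner_hermiteONB_sq k f
  rw [h, norm_zero, zero_pow two_ne_zero, eq_comm,
    div_eq_zero_iff, or_iff_left (pow_pos (norm_hermiteLp_pos k) 2).ne'] at h2
  simpa using h2

/-- Parseval's identity for the Hermite functions. -/
theorem hasSum_norm_inner_hermiteONB_sq (f : L2R) :
    HasSum (fun k => ‖inner ℂ (hermiteONB k) f‖ ^ 2) (‖f‖ ^ 2) := by
  have h := (HilbertBasis.mkOfOrthogonalEqBot orthonormal_hermiteONB
    hermiteONB_orthogonal_eq_bot).hasSum_inner_mul_inner f f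
  simp only [HilbertBasis.coe_mkOfOrthogonalEqBot] at h
  have h' := (Complex.hasSum_re h)
  rw [inner_self_eq_norm_sq_to_K] at h'
  convert h' using 1
  · funext k
    rw [← inner_conj_symm f, Complex.conj_mul']
    norm_cast
  · norm_cast

/-! ### Second moments -/

theorem integral_norm_sq_eq_norm_sq (f : L2R) : ∫ t, ‖f t‖ ^ 2 = ‖f‖ ^ 2 := by
  have h := L2.inner_def (𝕜 := ℂ) f f
  rw [inner_self_eq_norm_sq_to_K] at h
  have h2 : ∀ t, inner ℂ (f t) (f t) = ((‖f t‖ ^ 2 : ℝ) : ℂ) := fun t => by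
    rw [inner_self_eq_norm_sq_to_K]; norm_cast
  simp_rw [h2] at h
  rw [integral_complex_ofReal] at h
  apply Complex.ofReal_injective
  rw [← h]
  push_cast
  rfl

/-- Bounds on dispersion and mean bound the second moment about the origin. -/
theorem exists_coe_eq_mul_and_norm_sq_le {f : L2R} (hf : ‖f‖ = 1) {C : ℝ}
    (hΔ : l2Dispersion f ≤ ENNReal.ofReal C) (hμ : |l2Mean f| ≤ C) :
    ∃ g : L2R, (∀ᵐ t : ℝ, g t = t * f t) ∧ ‖g‖ ^ 2 ≤ 2 * C ^ 2 := by
  have hC : 0 ≤ C := (abs_nonneg _).trans hμ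
  set m := l2Mean f with hm
  have hvar : l2Variance f ≤ ENNReal.ofReal (C ^ 2) := by
    have h := ENNReal.rpow_le_rpow hΔ (z := 2) (by norm_num)
    rw [l2Dispersion, ← ENNReal.rpow_mul] at h
    norm_num at h
    rwa [ENNReal.ofReal_pow hC]
  have hcont : AEStronglyMeasurable (fun t : ℝ => ((t - m : ℝ) : ℂ) * f t) volume := by
    have : Continuous (fun t : ℝ => ((t - m : ℝ) : ℂ)) := by fun_prop
    exact this.aestronglyMeasurable.mul (Lp.aestronglyMeasurable f)
  have hsq : ∀ t : ℝ, |t - m| ^ 2 * ‖f t‖ ^ 2 = ‖((t - m : ℝ) : ℂ) * f t‖ ^ 2 := fun t => by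
    rw [norm_mul, Complex.norm_real, Real.norm_eq_abs, mul_pow]
  have hmeas : AEStronglyMeasurable (fun t : ℝ => |t - m| ^ 2 * ‖f t‖ ^ 2) volume := by
    simp_rw [hsq]
    exact hcont.norm.pow 2
  have hint : Integrable (fun t : ℝ => |t - m| ^ 2 * ‖f t‖ ^ 2) := by
    refine ⟨hmeas, ?_⟩
    rw [hasFiniteIntegral_iff_ofReal (Filter.Eventually.of_forall fun t => by positivity)]
    exact hvar.trans_lt ENNReal.ofReal_lt_top
  have hu : MemLp (fun t : ℝ => ((t - m : ℝ) : ℂ) * f t) 2 volume := by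
    rw [memLp_two_iff_integrable_sq_norm hcont]
    simpa only [hsq] using hint
  have hg : MemLp (fun t : ℝ => (t : ℂ) * f t) 2 volume := by
    have := hu.add ((Lp.memLp f).const_mul (m : ℂ))
    refine this.ae_eq (Filter.Eventually.of_forall fun t => ?_)
    simp only [Pi.add_apply]
    push_cast
    ring
  have hval : ∫ t : ℝ, |t - m| ^ 2 * ‖f t‖ ^ 2 ≤ C ^ 2 := by
    rw [integral_eq_lintegral_of_nonneg_ae (Filter.Eventually.of_forall fun t => by positivity)
      hmeas]
    exact ENNReal.toReal_le_of_le_ofReal (by positivity) hvar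
  have hf2 : Integrable (fun t : ℝ => ‖f t‖ ^ 2) := (Lp.memLp f).integrable_norm_pow two_ne_zero
  have h1 : Integrable (fun t : ℝ => t * ‖f t‖ ^ 2) := by
    have := (hg.integrable_mul (Lp.memLp f).star).re
    refine this.congr (Filter.Eventually.of_forall fun t => ?_)
    simp only [Pi.mul_apply, Pi.star_apply, RCLike.star_def, mul_assoc]
    rw [Complex.mul_conj']
    norm_cast
  have hm1 : ∫ t : ℝ, t * ‖f t‖ ^ 2 = m := by rw [hm, l2Mean, hf]; simp
  refine ⟨hg.toLp _, hg.coeFn_toLp, ?_⟩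
  rw [← integral_norm_sq_eq_norm_sq]
  -- As `t² = (t - m)² + 2mt - m²` and `‖f‖ = 1`, the second moment is variance plus `m²`, each at
  -- most `C²`.
  have : ∫ t : ℝ, ‖hg.toLp _ t‖ ^ 2 =
      ∫ t : ℝ, (|t - m| ^ 2 * ‖f t‖ ^ 2 + (2 * m) * (t * ‖f t‖ ^ 2)) - m ^ 2 * ‖f t‖ ^ 2 := by
    refine integral_congr_ae ?_
    filter_upwards [hg.coeFn_toLp] with t ht
    rw [ht, norm_mul, Complex.norm_real, Real.norm_eq_abs, mul_pow, sq_abs, sq_abs]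
    ring
  rw [this, integral_sub (by exact hint.add (h1.const_mul _)) (hf2.const_mul _),
    integral_add hint (h1.const_mul _), integral_const_mul, integral_const_mul, hm1,
    integral_norm_sq_eq_norm_sq, hf]
  have := sq_le_sq' (abs_le.1 hμ).1 (abs_le.1 hμ).2
  nlinarith

/-! ### Energy of Hermite coefficients -/

theorem inner_toLp_coe_mul {f g : L2R} (hg : ∀ᵐ t : ℝ, g t = t * f t) (φ : 𝓢(ℝ, ℂ)) :
    inner ℂ (φ.toLp 2 volume) g = inner ℂ ((mulX φ).toLp 2 volume) f := by
  rw [inner_toLp_eq_integral, inner_toLp_eq_integral]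
  refine integral_congr_ae ?_
  filter_upwards [hg] with t ht
  simp [ht, mulX_apply]
  ring

theorem inner_hermiteLp_coe_mul {f g : L2R} (hg : ∀ᵐ t : ℝ, g t = t * f t) (k : ℕ) :
    4 * Real.pi * inner ℂ (hermiteLp k) g =
      inner ℂ (hermiteLp (k + 1)) f + 4 * Real.pi * k * inner ℂ (hermiteLp (k - 1)) f := by
  have h : (4 * Real.pi : ℂ) • (mulX (hermiteFun k)).toLp 2 (volume : Measure ℝ) =
      hermiteLp (k + 1) + (4 * Real.pi * k : ℂ) • hermiteLp (k - 1) := by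
    rw [← toLp_smul_schwartz, mulX_hermiteFun]
    rfl
  have h2 := congrArg (fun v => inner ℂ v f) h
  have h4 : (starRingEnd ℂ) 4 = 4 := map_ofNat _ 4
  rw [hermiteLp]
  simpa [inner_add_left, inner_smul_left, h4, ← inner_toLp_coe_mul hg] using h2

/-- The coefficients of `t f` and `t 𝓕f` are, up to common factors and a phase, `b + c` and `b - c`:
the eigenvalues `(-i)^(k+1)` and `(-i)^(k-1)` have opposite signs. The parallelogram law removes the
cross terms. -/
theorem norm_sq_add_norm_sq_inner_hermiteONB {f g g' : L2R} (hg : ∀ᵐ t : ℝ, g t = t * f t)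
    (hg' : ∀ᵐ t : ℝ, g' t = t * 𝓕 f t) (k : ℕ) :
    2 * Real.pi * (‖inner ℂ (hermiteONB k) g‖ ^ 2 + ‖inner ℂ (hermiteONB k) g'‖ ^ 2) =
      (k + 1) * ‖inner ℂ (hermiteONB (k + 1)) f‖ ^ 2 +
        k * ‖inner ℂ (hermiteONB (k - 1)) f‖ ^ 2 := by
  have h1 := inner_hermiteLp_coe_mul hg k
  have h2 := inner_hermiteLp_coe_mul hg' k
  set b := inner ℂ (hermiteLp (k + 1)) f with hb
  set c := 4 * Real.pi * k * inner ℂ (hermiteLp (k - 1)) f with hc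
  have h3 : 4 * Real.pi * inner ℂ (hermiteLp k) g' = (-Complex.I) ^ (k + 1) * (b - c) := by
    rw [h2, inner_hermiteLp_fourier, inner_hermiteLp_fourier]
    cases k with
    | zero => simp [hb, hc]
    | succ k =>
      rw [Nat.add_sub_cancel] at hc ⊢
      have : (-Complex.I) ^ (k + 1 + 1) = - (-Complex.I) ^ k := by
        rw [pow_succ, pow_succ, mul_assoc]; simp
      rw [hc, this]
      ring
  have h4π : ‖(4 * Real.pi : ℂ)‖ = 4 * Real.pi := by simp [abs_of_pos Real.pi_pos]
  have hn1 : (4 * Real.pi) ^ 2 * ‖inner ℂ (hermiteLp k) g‖ ^ 2 = ‖b + c‖ ^ 2 := by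
    rw [← h1, norm_mul, h4π, ← mul_pow]
  have hn2 : (4 * Real.pi) ^ 2 * ‖inner ℂ (hermiteLp k) g'‖ ^ 2 = ‖b - c‖ ^ 2 := by
    have : ‖b - c‖ = ‖4 * Real.pi * inner ℂ (hermiteLp k) g'‖ := by
      rw [h3, norm_mul, norm_pow]; simp
    rw [this, norm_mul, h4π, ← mul_pow]
  have hpar : ‖b + c‖ ^ 2 + ‖b - c‖ ^ 2 = 2 * (‖b‖ ^ 2 + ‖c‖ ^ 2) := by
    have := parallelogram_law_with_norm ℝ b c
    linarith
  have hcn : ‖c‖ ^ 2 = (4 * Real.pi * k) ^ 2 * ‖inner ℂ (hermiteLp (k - 1)) f‖ ^ 2 := by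
    rw [hc, norm_mul, mul_pow]
    simp [abs_of_pos Real.pi_pos]
  have hp := Real.pi_pos
  have hk := norm_hermiteLp_pos k
  rw [norm_inner_hermiteONB_sq, norm_inner_hermiteONB_sq, norm_inner_hermiteONB_sq,
    norm_inner_hermiteONB_sq, norm_hermiteLp_succ_sq, ← hb]
  have hlow : (k : ℝ) * (‖inner ℂ (hermiteLp (k - 1)) f‖ ^ 2 / ‖hermiteLp (k - 1)‖ ^ 2) =
      ‖c‖ ^ 2 / (4 * Real.pi * ‖hermiteLp k‖ ^ 2) := by
    rw [hcn]
    cases k with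
    | zero => simp
    | succ k =>
      rw [norm_hermiteLp_succ_sq, Nat.add_sub_cancel]
      have := norm_hermiteLp_pos k
      push_cast
      field_simp
  rw [hlow]
  field_simp
  nlinarith

/-- The quadratic form of the harmonic oscillator dominates the Hermite energies. -/
theorem sum_hermite_energy_le {f g g' : L2R} (hg : ∀ᵐ t : ℝ, g t = t * f t)
    (hg' : ∀ᵐ t : ℝ, g' t = t * 𝓕 f t) (K : ℕ) :
    ∑ k ∈ Finset.range K, (2 * k + 1 : ℝ) * ‖inner ℂ (hermiteONB k) f‖ ^ 2 ≤
      2 * Real.pi * (‖g‖ ^ 2 + ‖g'‖ ^ 2) := by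
  -- One index beyond `K` is needed: the terms in `k - 1` reach level `K - 1` only at `k = K`.
  have h1 := orthonormal_hermiteONB.sum_inner_products_le g (s := Finset.range (K + 1))
  have h2 := orthonormal_hermiteONB.sum_inner_products_le g' (s := Finset.range (K + 1))
  refine le_trans ?_ (mul_le_mul_of_nonneg_left (add_le_add h1 h2) (by positivity))
  rw [← Finset.sum_add_distrib, Finset.mul_sum]
  simp_rw [norm_sq_add_norm_sq_inner_hermiteONB hg hg']
  rw [Finset.sum_add_distrib, Finset.sum_range_succ' (fun k => (k : ℝ) *
    ‖inner ℂ (hermiteONB (k - 1)) f‖ ^ 2)]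
  have h3 : ∑ k ∈ Finset.range K, (k : ℝ) * ‖inner ℂ (hermiteONB k) f‖ ^ 2 ≤
      ∑ k ∈ Finset.range (K + 1), ((k : ℝ) + 1) * ‖inner ℂ (hermiteONB (k + 1)) f‖ ^ 2 := by
    have h4 := Finset.sum_range_succ' (fun k : ℕ => (k : ℝ) * ‖inner ℂ (hermiteONB k) f‖ ^ 2) (K + 1)
    push_cast at h4
    rw [zero_mul, add_zero] at h4
    rw [← h4]
    exact Finset.sum_le_sum_of_subset_of_nonneg (Finset.range_subset_range.2 (by omega))
      fun _ _ _ => by positivity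
  have h5 : ∑ k ∈ Finset.range K, (2 * k + 1 : ℝ) * ‖inner ℂ (hermiteONB k) f‖ ^ 2 =
      ∑ k ∈ Finset.range K, (k : ℝ) * ‖inner ℂ (hermiteONB k) f‖ ^ 2 +
      ∑ k ∈ Finset.range K, ((k : ℝ) + 1) * ‖inner ℂ (hermiteONB k) f‖ ^ 2 := by
    rw [← Finset.sum_add_distrib]
    exact Finset.sum_congr rfl fun _ _ => by ring
  rw [h5]
  simpa using h3

/-- If weights `0 ≤ w k ≤ 1` have total mass `N` then `∑ (2k+1) w k ≥ N²`. -/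
theorem sq_le_of_hasSum {w : ℕ → ℝ} {N : ℕ} {B : ℝ} (h0 : ∀ k, 0 ≤ w k) (h1 : ∀ k, w k ≤ 1)
    (hw : HasSum w N) (hB : ∀ K, ∑ k ∈ Finset.range K, (2 * k + 1 : ℝ) * w k ≤ B) :
    (N : ℝ) ^ 2 ≤ B := by
  have hodd : ∑ k ∈ Finset.range N, (2 * (k : ℝ) + 1) = (N : ℝ) ^ 2 := by
    clear hw
    induction N with
    | zero => simp
    | succ n ih => rw [Finset.sum_range_succ, ih]; push_cast; ring
  have key : ∀ K ≥ N, 2 * N * ∑ k ∈ Finset.range K, w k ≤ B + (N : ℝ) ^ 2 := by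
    intro K hK
    -- After subtracting `2N` the coefficients are negative exactly for `k < N`, so the minimum has
    -- `w k = 1` there and `0` beyond: `N² - 2N²`.
    have hlow : -(N : ℝ) ^ 2 ≤ ∑ k ∈ Finset.range K, (2 * k + 1 - 2 * N : ℝ) * w k := by
      calc -(N : ℝ) ^ 2 = ∑ k ∈ Finset.range N, (2 * k + 1 - 2 * N : ℝ) := by
            rw [Finset.sum_sub_distrib, hodd]; simp; ring
        _ ≤ ∑ k ∈ Finset.range N, (2 * k + 1 - 2 * N : ℝ) * w k := by
            refine Finset.sum_le_sum fun k hk => ?_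
            have : (k : ℝ) + 1 ≤ N := by exact_mod_cast Finset.mem_range.1 hk
            nlinarith [h1 k, h0 k]
        _ ≤ _ := by
            refine Finset.sum_le_sum_of_subset_of_nonneg (Finset.range_subset_range.2 hK)
              fun k _ hk => mul_nonneg ?_ (h0 k)
            have : (N : ℝ) ≤ k := by exact_mod_cast not_lt.1 (mt Finset.mem_range.2 hk)
            linarith
    have hsplit : ∑ k ∈ Finset.range K, (2 * k + 1 - 2 * N : ℝ) * w k =
        ∑ k ∈ Finset.range K, (2 * k + 1 : ℝ) * w k - 2 * N * ∑ k ∈ Finset.range K, w k := by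
      rw [Finset.mul_sum, ← Finset.sum_sub_distrib]
      exact Finset.sum_congr rfl fun _ _ => by ring
    linarith [hB K]
  have hlim := (hw.tendsto_sum_nat.const_mul (2 * N : ℝ))
  have := le_of_tendsto hlim (Filter.eventually_atTop.2 ⟨N, key⟩)
  nlinarith

/-- The bound is uniform over finite subfamilies, which also rules out infinite families. -/
theorem card_le_of_orthonormal {ι : Type*} {e : ι → L2R} (he : Orthonormal ℂ e) {C : ℝ}
    (hΔ : ∀ k, l2Dispersion (e k) ≤ ENNReal.ofReal C)
    (hΔF : ∀ k, l2Dispersion (𝓕 (e k)) ≤ ENNReal.ofReal C)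
    (hμ : ∀ k, |l2Mean (e k)| ≤ C) (hμF : ∀ k, |l2Mean (𝓕 (e k))| ≤ C) (s : Finset ι) :
    (s.card : ℝ) ≤ 8 * Real.pi * C ^ 2 := by
  have hnF : ∀ i, ‖𝓕 (e i)‖ = 1 := fun i => (Lp.norm_fourier_eq _).trans (he.1 i)
  choose g hg hgn using fun i => exists_coe_eq_mul_and_norm_sq_le (he.1 i) (hΔ i) (hμ i)
  choose g' hg' hgn' using fun i => exists_coe_eq_mul_and_norm_sq_le (hnF i) (hΔF i) (hμF i)
  have hsum : HasSum (fun k => ∑ i ∈ s, ‖inner ℂ (hermiteONB k) (e i)‖ ^ 2) (s.card : ℝ) := by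
    have := hasSum_sum (s := s) fun i _ => hasSum_norm_inner_hermiteONB_sq (e i)
    simpa [he.1] using this
  have hle : ∀ k, ∑ i ∈ s, ‖inner ℂ (hermiteONB k) (e i)‖ ^ 2 ≤ 1 := by
    intro k
    have := he.sum_inner_products_le (hermiteONB k) (s := s)
    rw [orthonormal_hermiteONB.1 k, one_pow] at this
    simpa only [norm_inner_symm (hermiteONB k)] using this
  have hsq := sq_le_of_hasSum (B := s.card * (8 * Real.pi * C ^ 2))
    (fun k => Finset.sum_nonneg fun i _ => by positivity) hle hsum (fun K => by
      simp_rw [Finset.mul_sum]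
      rw [Finset.sum_comm, ← nsmul_eq_mul]
      refine Finset.sum_le_card_nsmul _ _ _ fun i _ => ?_
      refine (sum_hermite_energy_le (hg i) (hg' i) K).trans ?_
      nlinarith [hgn i, hgn' i, Real.pi_pos])
  rcases s.card.eq_zero_or_pos with h | h
  · rw [h, Nat.cast_zero]; positivity
  · have : (0 : ℝ) < s.card := by exact_mod_cast h
    rw [sq] at hsq
    exact le_of_mul_le_mul_left hsq this

theorem mainTheorem2 {ι : Type*} (e : ι → L2R) (he : Orthonormal ℂ e) (C : ℝ)
    (hΔ : ∀ k, l2Dispersion (e k) ≤ ENNReal.ofReal C)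
    (hΔF : ∀ k, l2Dispersion (𝓕 (e k)) ≤ ENNReal.ofReal C)
    (hμ : ∀ k, |l2Mean (e k)| ≤ C)
    (hμF : ∀ k, |l2Mean (𝓕 (e k))| ≤ C) :
    Finite ι ∧ (Nat.card ι : ℝ) ≤ 8 * Real.pi * C ^ 2 := by
  have hcard := card_le_of_orthonormal he hΔ hΔF hμ hμF
  have hfin : Finite ι := by
    by_contra hinf
    rw [not_finite_iff_infinite] at hinf
    obtain ⟨n, hn⟩ := exists_nat_gt (8 * Real.pi * C ^ 2)
    obtain ⟨s, hs⟩ := Infinite.exists_subset_card_eq ι n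
    exact absurd (hcard s) (not_le.2 (hs ▸ hn))
  refine ⟨hfin, ?_⟩
  have := Fintype.ofFinite ι
  rw [Nat.card_eq_fintype_card, ← Finset.card_univ]
  exact hcard Finset.univ
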